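/- Let $N\ge 2$. For an integer $K\ge 1$ let $C(S^{N-1}_{\mathbb C,K})$ (the algebra of the $K$-half-liberated complex sphere) be the universal unital $C^*$-algebra generated by elements $z_1,\dots,z_N$ subject to the relations $$\sum_{i=1}^N z_iz_i^*=1=\sum_{i=1}^N z_i^*z_i,\qquad [z_{i_1}\cdots z_{i_K},\,z_{j_1}\cdots z_{j_K}]=0=[z_{i_1}\cdots z_{i_K},\,z_{j_1}^*\cdots z_{j_K}^*]$$ for all $i_1,\dots,i_K,j_1,\dots,j_K\in\{1,\dots,N\}$, that is, the completion of the $*$-algebra of noncommutative polynomials in $z_i,z_i^*$ with respect to the biggest $C^*$-seminorm that vanishes on these relations. Representations are unital $*$-representations by bounded operators on complex Hilbert spaces; a representation on $H$ is irreducible if $H\neq 0$ and the only closed invariant subspaces are $0$ and $H$. Then, for every $K\ge 1$: 1. $C(S^{N-1}_{\mathbb C,K})$ has an irreducible representation of dimension $K$. 2. Every irreducible representation of $C(S^{N-1}_{\mathbb C,K})$ is finite dimensional, of dimension $\le K$. In particular, for $K,K'\ge 1$ with $K\neq K'$, the $C^*$-algebras $C(S^{N-1}_{\mathbb C,K})$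 and $C(S^{N-1}_{\mathbb C,K'})$ are not isomorphic. -/

import Mathlib

noncomputable section

open scoped ComplexConjugate

/-! ### Noncommutative `*`-polynomials -/

/-- Words in the letters `(i, true)`, read as `zᵢ`, and `(i, false)`, read as `zᵢ*`. -/
abbrev StarWord (N : ℕ) : Type := FreeMonoid (Fin N × Bool)

/-- The adjoint of a word: reverse it and exchange `zᵢ` and `zᵢ*` in each letter. -/
def StarWord.adj {N : ℕ} (w : StarWord N) : StarWord N :=
  FreeMonoid.ofList ((w.toList.map fun l => (l.1, !l.2)).reverse)

lemma StarWord.adj_mul {N : ℕ} (v w : StarWord N) : (v * w).adj = w.adj * v.adj := by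
  simp [StarWord.adj]

lemma StarWord.adj_adj {N : ℕ} (w : StarWord N) : w.adj.adj = w := by
  simp [StarWord.adj, List.map_reverse, Function.comp_def]

/-- The free unital complex algebra `ℂ⟨z₁, …, z_N, z₁*, …, z_N*⟩`: finite complex linear
combinations of words, multiplied by concatenation. -/
def StarPoly (N : ℕ) : Type := MonoidAlgebra ℂ (StarWord N)

namespace StarPoly

variable {N : ℕ}

instance : Ring (StarPoly N) := inferInstanceAs (Ring (MonoidAlgebra ℂ (StarWord N)))

instance : Algebra ℂ (StarPoly N) := inferInstanceAs (Algebra ℂ (MonoidAlgebra ℂ (StarWord N)))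

/-- The monomial `c w`. -/
def monomial (w : StarWord N) (c : ℂ) : StarPoly N := MonoidAlgebra.single w c

/-- The conjugate-linear antimultiplicative involution, `∑ c_w w ↦ ∑ conj(c_w) w*`. -/
def adj (f : StarPoly N) : StarPoly N :=
  MonoidAlgebra.ofCoeff
    ((Finsupp.mapRange conj (map_zero conj) (MonoidAlgebra.coeff f)).mapDomain StarWord.adj)

lemma adj_monomial (w : StarWord N) (c : ℂ) : adj (monomial w c) = monomial w.adj (conj c) := by
  simp only [adj, monomial, MonoidAlgebra.coeff_single, Finsupp.mapRange_single,
    Finsupp.mapDomain_single]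
  rfl

lemma adj_add (f g : StarPoly N) : adj (f + g) = adj f + adj g := by
  have h : MonoidAlgebra.coeff (f + g) = MonoidAlgebra.coeff f + MonoidAlgebra.coeff g := rfl
  simp only [adj, h, Finsupp.mapRange_add (map_add conj), Finsupp.mapDomain_add]
  rfl

lemma adj_zero : adj (0 : StarPoly N) = 0 := by
  have h : MonoidAlgebra.coeff (0 : StarPoly N) = 0 := rfl
  simp only [adj, h, Finsupp.mapRange_zero, Finsupp.mapDomain_zero]
  rfl

lemma induction_monomial {motive : StarPoly N → Prop} (f : StarPoly N) (zero : motive 0)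
    (add : ∀ f g, motive f → motive g → motive (f + g))
    (mono : ∀ w c, motive (monomial w c)) : motive f :=
  MonoidAlgebra.induction_linear f zero add mono

lemma monomial_mul (v w : StarWord N) (c d : ℂ) :
    monomial v c * monomial w d = monomial (v * w) (c * d) :=
  MonoidAlgebra.single_mul_single ..

lemma smul_monomial (w : StarWord N) (c d : ℂ) : c • monomial w d = monomial w (c * d) :=
  MonoidAlgebra.smul_single ..

instance : StarRing (StarPoly N) where
  star := adj
  star_involutive f := by
    induction f using induction_monomial with
    | zero => simp only [adj_zero]
    | add f g hf hg => simp only [adj_add, hf, hg]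
    | mono w c => simp [adj_monomial, StarWord.adj_adj]
  star_mul f g := by
    show adj (f * g) = adj g * adj f
    induction f using induction_monomial with
    | zero => simp [adj_zero]
    | add f f' hf hf' => simp only [add_mul, mul_add, adj_add, hf, hf']
    | mono v c =>
      induction g using induction_monomial with
      | zero => simp [adj_zero]
      | add g g' hg hg' => simp only [add_mul, mul_add, adj_add, hg, hg']
      | mono w d =>
        simp only [adj_monomial, monomial_mul, StarWord.adj_mul, map_mul, mul_comm]
  star_add := adj_add

instance : StarModule ℂ (StarPoly N) where
  star_smul c f := by
    show adj (c • f) = conj c • adj f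
    induction f using induction_monomial with
    | zero => simp [adj_zero]
    | add f g hf hg => simp only [smul_add, adj_add, hf, hg]
    | mono w d => simp only [smul_monomial, adj_monomial, map_mul]

/-- The coordinate `zᵢ`; its adjoint `star (z i)` is the letter `zᵢ*`. -/
def z (i : Fin N) : StarPoly N := monomial (FreeMonoid.of (i, true)) 1

lemma star_z (i : Fin N) : star (z i) = monomial (FreeMonoid.of (i, false)) 1 := by
  show adj (z i) = _
  rw [z, adj_monomial, map_one]
  rfl

end StarPoly

/-! ### `C*`-seminorms and the associated completions -/

/-- A `C*`-seminorm on a complex `*`-algebra: a submultiplicative seminorm `p` such that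
`p (x* x) = p(x)²`. -/
structure CStarSeminorm (P : Type*) [Ring P] [StarRing P] [Algebra ℂ P] extends
    Seminorm ℂ P where
  mul_le' : ∀ x y, toFun (x * y) ≤ toFun x * toFun y
  star_mul_self' : ∀ x, toFun (star x * x) = toFun x ^ 2

namespace CStarSeminorm

variable {P : Type*} [Ring P] [StarRing P] [Algebra ℂ P]

instance : CoeFun (CStarSeminorm P) fun _ => P → ℝ := ⟨fun p => p.toSeminorm⟩

lemma mul_le (p : CStarSeminorm P) (x y : P) : p (x * y) ≤ p x * p y := p.mul_le' x y

lemma star_mul_self (p : CStarSeminorm P) (x : P) : p (star x * x) = p x ^ 2 :=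
  p.star_mul_self' x

lemma nonneg (p : CStarSeminorm P) (x : P) : 0 ≤ p x := apply_nonneg p.toSeminorm x

lemma map_one_le (p : CStarSeminorm P) : p 1 ≤ 1 := by
  have h := p.star_mul_self 1
  rw [star_one, one_mul] at h
  nlinarith [p.nonneg 1]

lemma le_star (p : CStarSeminorm P) (x : P) : p x ≤ p (star x) := by
  have h := p.mul_le (star x) x
  rw [star_mul_self] at h
  by_contra! hlt
  nlinarith [p.nonneg x, p.nonneg (star x)]

lemma map_star (p : CStarSeminorm P) (x : P) : p (star x) = p x :=
  le_antisymm (by simpa using p.le_star (star x)) (p.le_star x)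

/-- The `*`-algebra `P`, equipped with the seminorm `p`. -/
@[nolint unusedArguments]
def Pre (_p : CStarSeminorm P) : Type _ := P

variable (p : CStarSeminorm P)

instance : Ring p.Pre := inferInstanceAs (Ring P)

instance : StarRing p.Pre := inferInstanceAs (StarRing P)

instance : Algebra ℂ p.Pre := inferInstanceAs (Algebra ℂ P)

instance [StarModule ℂ P] : StarModule ℂ p.Pre := inferInstanceAs (StarModule ℂ P)

instance : SeminormedRing p.Pre :=
  { (inferInstance : Ring p.Pre),
    p.toSeminorm.toAddGroupSeminorm.toSeminormedAddCommGroup with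
    norm_mul_le := p.mul_le }

lemma norm_pre (x : p.Pre) : ‖x‖ = p x := rfl

instance : NormedAlgebra ℂ p.Pre where
  norm_smul_le c x := (map_smul_eq_mul p.toSeminorm c x).le

instance : NormedStarGroup p.Pre where
  norm_star_le x := (p.map_star x).le

/-- The Hausdorff completion of `P` with respect to `p`. -/
def Compl : Type _ := UniformSpace.Completion p.Pre

namespace Compl

open UniformSpace

instance : NormedRing p.Compl := inferInstanceAs (NormedRing (Completion p.Pre))

instance : CompleteSpace p.Compl := inferInstanceAs (CompleteSpace (Completion p.Pre))

instance : Algebra ℂ p.Compl := inferInstanceAs (Algebra ℂ (Completion p.Pre))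

instance : NormedAlgebra ℂ p.Compl where
  norm_smul_le c x := norm_smul_le (β := Completion p.Pre) c x

/-- The canonical map from `P` to the completion. -/
def of (x : P) : p.Compl := ((show p.Pre from x : p.Pre) : Completion p.Pre)

lemma norm_of (x : P) : ‖of p x‖ = p x := Completion.norm_coe (E := p.Pre) x

lemma of_add (x y : P) : of p (x + y) = of p x + of p y := Completion.coe_add (α := p.Pre) x y

lemma of_mul (x y : P) : of p (x * y) = of p x * of p y := Completion.coe_mul (α := p.Pre) x y

lemma of_one : of p 1 = 1 := rfl

lemma of_smul (c : ℂ) (x : P) : of p (c • x) = c • of p x := Completion.coe_smul (X := p.Pre) c x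

lemma denseRange_of : DenseRange (of p) := Completion.denseRange_coe (α := p.Pre)

/-- The involution of the completion, the continuous extension of that of `P`. -/
instance : Star p.Compl := ⟨Completion.map (star : p.Pre → p.Pre)⟩

lemma star_of (x : P) : star (of p x) = of p (star x) :=
  Completion.map_coe (α := p.Pre) (starNormedAddGroupHom (E := p.Pre)).uniformContinuous x

lemma continuous_star : Continuous (star : p.Compl → p.Compl) :=
  Completion.continuous_map (α := p.Pre)

lemma induction_of {motive : p.Compl → Prop} (x : p.Compl) (hc : IsClosed {x | motive x})
    (h : ∀ x, motive (of p x)) : motive x :=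
  isClosed_property (denseRange_of p) hc h x

instance : StarRing p.Compl where
  star_involutive x := by
    induction x using induction_of with
    | hc => exact isClosed_eq ((continuous_star p).comp (continuous_star p)) continuous_id
    | h x => rw [star_of, star_of, star_star]
  star_mul x y := by
    have hs := continuous_star p
    induction x using induction_of with
    | hc => exact isClosed_eq (by fun_prop) (by fun_prop)
    | h x =>
      induction y using induction_of with
      | hc => exact isClosed_eq (by fun_prop) (by fun_prop)
      | h y => simp only [star_of, ← of_mul, star_mul]
  star_add x y := by
    have hs := continuous_star p
    induction x using induction_of with
    | hc => exact isClosed_eq (by fun_prop) (by fun_prop)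
    | h x =>
      induction y using induction_of with
      | hc => exact isClosed_eq (by fun_prop) (by fun_prop)
      | h y => simp only [star_of, ← of_add, star_add]

instance : CStarRing p.Compl where
  norm_mul_self_le x := by
    have hs := continuous_star p
    induction x using induction_of with
    | hc => exact isClosed_le (by fun_prop) (by fun_prop)
    | h x => rw [star_of, ← of_mul, norm_of, norm_of, star_mul_self, sq]

instance [StarModule ℂ P] : StarModule ℂ p.Compl where
  star_smul c x := by
    induction x using induction_of with
    | hc =>
      exact isClosed_eq ((continuous_star p).comp (continuous_const_smul c))
        ((continuous_star p).const_smul (star c))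
    | h x =>
      rw [star_of, ← of_smul, ← of_smul, star_of]
      exact congrArg (of p) (star_smul c x)

/-- The completion of a `*`-algebra with respect to a `C*`-seminorm is a `C*`-algebra. -/
instance [StarModule ℂ P] : CStarAlgebra p.Compl where

/-- The canonical map as a morphism of `*`-algebras. -/
def ofHom [StarModule ℂ P] : P →⋆ₐ[ℂ] p.Compl where
  toFun := of p
  map_one' := of_one p
  map_mul' := of_mul p
  map_zero' := Completion.coe_zero (α := p.Pre)
  map_add' := of_add p
  commutes' c := by
    rw [Algebra.algebraMap_eq_smul_one, of_smul, of_one, Algebra.algebraMap_eq_smul_one]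
  map_star' x := (star_of p x).symm

end Compl

end CStarSeminorm

/-! ### Algebraic noncommutative submanifolds of the free complex sphere -/

namespace FreeSphere

open StarPoly

variable {N : ℕ}

/-- The relators of the free complex sphere: `∑ zᵢ zᵢ* - 1` and `∑ zᵢ* zᵢ - 1`. -/
def sphereRelators (N : ℕ) : Set (StarPoly N) :=
  {∑ i, z i * star (z i) - 1, ∑ i, star (z i) * z i - 1}

/-- The `C*`-seminorms on `ℂ⟨zᵢ, zᵢ*⟩` which vanish on the sphere relators and on `R`. -/
def Admissible (R : Set (StarPoly N)) : Type :=
  {p : CStarSeminorm (StarPoly N) // ∀ r ∈ sphereRelators N ∪ R, p r = 0}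

/-- The zero seminorm. -/
def zeroAdmissible (R : Set (StarPoly N)) : Admissible R :=
  ⟨{ toSeminorm := 0
     mul_le' := fun _ _ => by change (0 : ℝ) ≤ 0 * 0; simp
     star_mul_self' := fun _ => by change (0 : ℝ) = 0 ^ 2; simp }, fun _ _ => rfl⟩

instance (R : Set (StarPoly N)) : Nonempty (Admissible R) := ⟨zeroAdmissible R⟩

lemma seminorm_z_le_one {R : Set (StarPoly N)} (p : Admissible R) (i : Fin N) :
    p.1 (z i) ≤ 1 := by
  let A := p.1.Compl
  let φ : StarPoly N →⋆ₐ[ℂ] A := CStarSeminorm.Compl.ofHom p.1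
  have hφ : ∀ x, ‖φ x‖ = p.1 x := CStarSeminorm.Compl.norm_of p.1
  let _ : PartialOrder A := CStarAlgebra.spectralOrder A
  have _ : StarOrderedRing A := CStarAlgebra.spectralOrderedRing A
  have hsum : ∑ j, star (φ (z j)) * φ (z j) = 1 := by
    have h0 : φ (∑ j, star (z j) * z j - 1) = 0 := by
      rw [← norm_eq_zero, hφ]
      exact p.2 _ (Or.inl (Or.inr rfl))
    rw [map_sub, map_one, sub_eq_zero, map_sum] at h0
    simpa only [map_mul, map_star] using h0
  have hle : star (φ (z i)) * φ (z i) ≤ 1 := by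
    rw [← hsum]
    exact Finset.single_le_sum (f := fun j => star (φ (z j)) * φ (z j))
      (fun j _ => star_mul_self_nonneg _) (Finset.mem_univ i)
  have h1 := (CStarAlgebra.norm_le_one_iff_of_nonneg _ (star_mul_self_nonneg (φ (z i)))).2 hle
  rw [CStarRing.norm_star_mul_self, hφ] at h1
  nlinarith [p.1.nonneg (z i)]

lemma seminorm_monomial_le {R : Set (StarPoly N)} (p : Admissible R) (w : StarWord N) :
    p.1 (monomial w 1) ≤ 1 := by
  induction w using FreeMonoid.inductionOn' with
  | one => exact p.1.map_one_le
  | of_mul l w ih =>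
    have hl : p.1 (monomial (FreeMonoid.of l) 1) ≤ 1 := by
      obtain ⟨i, _ | _⟩ := l
      · rw [← star_z, p.1.map_star]
        exact seminorm_z_le_one p i
      · exact seminorm_z_le_one p i
    have h : (monomial (FreeMonoid.of l * w) 1 : StarPoly N)
        = monomial (FreeMonoid.of l) 1 * monomial w 1 := by
      rw [monomial_mul, one_mul]
    rw [h]
    exact (p.1.mul_le _ _).trans (mul_le_one₀ hl (p.1.nonneg _) ih)

/-- The admissible `C*`-seminorms are uniformly bounded at every polynomial. -/
lemma bddAbove_seminorms (R : Set (StarPoly N)) (x : StarPoly N) :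
    BddAbove (Set.range fun p : Admissible R => p.1 x) := by
  suffices h : ∃ C : ℝ, ∀ p : Admissible R, p.1 x ≤ C by
    obtain ⟨C, hC⟩ := h
    exact ⟨C, by rintro _ ⟨p, rfl⟩; exact hC p⟩
  induction x using induction_monomial with
  | zero => exact ⟨0, fun p => (map_zero p.1.toSeminorm).le⟩
  | add f g hf hg =>
    obtain ⟨C, hC⟩ := hf
    obtain ⟨D, hD⟩ := hg
    exact ⟨C + D, fun p => (map_add_le_add p.1.toSeminorm f g).trans (add_le_add (hC p) (hD p))⟩
  | mono w c =>
    refine ⟨‖c‖, fun p => ?_⟩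
    have h : (monomial w c : StarPoly N) = c • monomial w 1 := by rw [smul_monomial, mul_one]
    rw [h, map_smul_eq_mul]
    exact mul_le_of_le_one_right (norm_nonneg c) (seminorm_monomial_le p w)

/-- The biggest `C*`-seminorm on `ℂ⟨zᵢ, zᵢ*⟩` which vanishes on the sphere relators and on `R`. -/
def maxSeminorm (R : Set (StarPoly N)) : CStarSeminorm (StarPoly N) where
  toFun x := ⨆ p : Admissible R, p.1 x
  map_zero' := by simp
  add_le' x y := ciSup_le fun p => (map_add_le_add p.1.toSeminorm x y).trans
    (add_le_add (le_ciSup (bddAbove_seminorms R x) p) (le_ciSup (bddAbove_seminorms R y) p))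
  neg' x := by simp
  smul' c x := by
    simp only [map_smul_eq_mul]
    exact (Real.mul_iSup_of_nonneg (norm_nonneg c) _).symm
  mul_le' x y := ciSup_le fun p => (p.1.mul_le x y).trans
    (mul_le_mul (le_ciSup (bddAbove_seminorms R x) p) (le_ciSup (bddAbove_seminorms R y) p)
      (p.1.nonneg y) ((p.1.nonneg x).trans (le_ciSup (bddAbove_seminorms R x) p)))
  star_mul_self' x := by
    have h0 : 0 ≤ ⨆ p : Admissible R, p.1 x := Real.iSup_nonneg fun p => p.1.nonneg x
    apply le_antisymm
    · refine ciSup_le fun p => ?_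
      rw [p.1.star_mul_self]
      exact pow_le_pow_left₀ (p.1.nonneg x) (le_ciSup (bddAbove_seminorms R x) p) 2
    · refine (Real.le_sqrt h0 (Real.iSup_nonneg fun p => p.1.nonneg _)).1 (ciSup_le fun p => ?_)
      refine Real.le_sqrt_of_sq_le ?_
      rw [← p.1.star_mul_self]
      exact le_ciSup (bddAbove_seminorms R (star x * x)) p

end FreeSphere

/-- The universal unital `C*`-algebra generated by `z₁, …, z_N` subject to the relations
`∑ zᵢ zᵢ* = 1 = ∑ zᵢ* zᵢ` and `r = 0` for `r ∈ R`: the completion of `ℂ⟨zᵢ, zᵢ*⟩` with respect to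
the biggest `C*`-seminorm compatible with these relations. -/
abbrev SphereCStar {N : ℕ} (R : Set (StarPoly N)) : Type := (FreeSphere.maxSeminorm R).Compl

/-- The monomial `z_{i₁} ⋯ z_{i_K}`. -/
def StarPoly.zProd {N K : ℕ} (i : Fin K → Fin N) : StarPoly N :=
  (List.ofFn fun k => StarPoly.z (i k)).prod

/-- The monomial `z_{i₁}* ⋯ z_{i_K}*`. -/
def StarPoly.zStarProd {N K : ℕ} (i : Fin K → Fin N) : StarPoly N :=
  (List.ofFn fun k => star (StarPoly.z (i k))).prod

/-- The relators `[z_{i₁} ⋯ z_{i_K}, z_{j₁} ⋯ z_{j_K}]` and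
`[z_{i₁} ⋯ z_{i_K}, z_{j₁}* ⋯ z_{j_K}*]`, for all multi-indices `i`, `j` of length `K`. -/
def halfLiberatedRelators (N K : ℕ) : Set (StarPoly N) :=
  {r | ∃ i j : Fin K → Fin N, r = ⁅StarPoly.zProd i, StarPoly.zProd j⁆} ∪
    {r | ∃ i j : Fin K → Fin N, r = ⁅StarPoly.zProd i, StarPoly.zStarProd j⁆}

/-- The `C*`-algebra `C(S^{N-1}_{ℂ,K})` of the `K`-half-liberated complex sphere. -/
abbrev HalfLiberatedSphere (N K : ℕ) : Type := SphereCStar (halfLiberatedRelators N K)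

/-! ### Irreducible representations -/

/-- A representation of a `C*`-algebra `A` on a Hilbert space `H` is irreducible if `H ≠ 0` and
the only closed subspaces invariant under `A` are `0` and `H`. -/
def IsIrreducibleRep {A H : Type*} [CStarAlgebra A] [NormedAddCommGroup H]
    [InnerProductSpace ℂ H] [CompleteSpace H] (π : A →⋆ₐ[ℂ] (H →L[ℂ] H)) : Prop :=
  Nontrivial H ∧ ∀ W : Submodule ℂ H, IsClosed (W : Set H) →
    (∀ a : A, ∀ v ∈ W, π a v ∈ W) → W = ⊥ ∨ W = ⊤

end

/-! Let B be the `*`-algebra generated by the words of length K (`core`). The relations make B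
commutative, and since the elements w w* sum to 1 over the words w of a fixed length, B also
contains every z_i z_j* and z_i* z_j. Hence σ(x) = ∑ z_k x z_k* satisfies σ(b) z_i = z_i b on B; it
restricts to a ring endomorphism of B, and σ^K = id there (`iterate_conjMap_eq_self`).

In an irreducible representation the σ-fixed elements of B are scalars by Schur's lemma. So each b
in B is a root of the scalar polynomial ∏ (X - σ^k(b)) (`isAlgebraic_of_mem_core`), and B, being
commutative and finitely generated, has a joint eigenvector η₀. All the z_i map the line of η₀ into
a single line, again of joint eigenvectors, and the z_i* map that line back (`exists_next`). The
resulting chain of lines closes up after K steps, because words of length K lie in B; its span is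
invariant and of dimension at most K (`finrank_le`).

The bound is attained by weighted cyclic shifts on ℂ^K: a product of K of them is diagonal, and
suitable weights make the action irreducible (`eq_bot_or_eq_top`). Thus K is the largest dimension
of an irreducible representation, which is an isomorphism invariant. -/

/-! ### The commutative algebra generated by the words of length `K` -/

/-- The defining relations of the `K`-half-liberated sphere, for a family in a `*`-ring, with the
words of length `K` indexed by lists. -/
structure IsHalfLiberated {N : ℕ} {E : Type*} [Ring E] [StarRing E] (K : ℕ) (Z : Fin N → E) :
    Prop where
  sum_mul_star : ∑ i, Z i * star (Z i) = 1
  sum_star_mul : ∑ i, star (Z i) * Z i = 1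
  commute : ∀ l l' : List (Fin N), l.length = K → l'.length = K →
    Commute (l.map Z).prod (l'.map Z).prod
  commute_star : ∀ l l' : List (Fin N), l.length = K → l'.length = K →
    Commute (l.map Z).prod (star (l'.map Z).prod)

namespace IsHalfLiberated

variable {N K : ℕ} {E : Type*} [Ring E] [StarRing E] {Z : Fin N → E}

/-- Since ∑ w w* = 1 over the words w of length n, u v is the sum of the u w w* v. Phrasing this as
membership avoids writing the sum over words; M = `core` yields membership results and M = ⊥ yields
equations. -/
lemma mul_mem_of_words (h : ∑ i, Z i * star (Z i) = 1) (M : AddSubmonoid E) (u v : E) (n : ℕ)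
    (hM : ∀ l : List (Fin N), l.length = n →
      u * ((l.map Z).prod * star (l.map Z).prod) * v ∈ M) : u * v ∈ M := by
  induction n with
  | zero => simpa using hM [] rfl
  | succ n ih =>
    refine ih fun l hl => ?_
    have : u * ((l.map Z).prod * star (l.map Z).prod) * v
        = ∑ i, u * (((l ++ [i]).map Z).prod * star ((l ++ [i]).map Z).prod) * v := by
      rw [← Finset.sum_mul, ← Finset.mul_sum]
      congr 2
      simp only [List.map_append, List.prod_append, List.map_cons, List.map_nil, List.prod_cons,
        List.prod_nil, mul_one, star_mul]
      calc _ = (l.map Z).prod * (∑ i, Z i * star (Z i)) * star (l.map Z).prod := by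
            rw [h, mul_one]
        _ = _ := by simp only [Finset.mul_sum, Finset.sum_mul, mul_assoc]
    rw [this]
    exact sum_mem fun i _ => hM _ (by simp [hl])

lemma mul_mem_of_star_words (h : ∑ i, star (Z i) * Z i = 1) (M : AddSubmonoid E) (u v : E)
    (n : ℕ) (hM : ∀ l : List (Fin N), l.length = n →
      u * (star (l.map Z).prod * (l.map Z).prod) * v ∈ M) : u * v ∈ M := by
  induction n with
  | zero => simpa using hM [] rfl
  | succ n ih =>
    refine ih fun l hl => ?_
    have : u * (star (l.map Z).prod * (l.map Z).prod) * v
        = ∑ i, u * (star ((i :: l).map Z).prod * ((i :: l).map Z).prod) * v := by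
      rw [← Finset.sum_mul, ← Finset.mul_sum]
      congr 2
      simp only [List.map_cons, List.prod_cons, star_mul]
      calc _ = star (l.map Z).prod * (∑ i, star (Z i) * Z i) * (l.map Z).prod := by
            rw [h, mul_one]
        _ = _ := by simp only [Finset.mul_sum, Finset.sum_mul, mul_assoc]
    rw [this]
    exact sum_mem fun i _ => hM _ (by simp [hl])

variable [Algebra ℂ E]

/-- The map `x ↦ ∑ zₖ x zₖ*`. -/
def conjMap (Z : Fin N → E) : E →ₗ[ℂ] E :=
  ∑ k, LinearMap.mulLeft ℂ (Z k) ∘ₗ LinearMap.mulRight ℂ (star (Z k))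

lemma conjMap_apply (x : E) : conjMap Z x = ∑ k, Z k * x * star (Z k) := by
  simp [conjMap, mul_assoc]

lemma conjMap_star (x : E) : conjMap Z (star x) = star (conjMap Z x) := by
  simp [conjMap_apply, mul_assoc]

lemma conjMap_algebraMap (h : IsHalfLiberated K Z) (c : ℂ) :
    conjMap Z (algebraMap ℂ E c) = algebraMap ℂ E c := by
  rw [Algebra.algebraMap_eq_smul_one, map_smul, conjMap_apply]
  simp [h.sum_mul_star]

variable [StarModule ℂ E]

/-- The words of length `K`. -/
def words (K : ℕ) (Z : Fin N → E) : Set E :=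
  {x | ∃ l : List (Fin N), l.length = K ∧ (l.map Z).prod = x}

/-- The `*`-algebra generated by the words of length `K`. -/
def core (K : ℕ) (Z : Fin N → E) : StarSubalgebra ℂ E := StarAlgebra.adjoin ℂ (words K Z)

lemma word_mem_core {l : List (Fin N)} (hl : l.length = K) : (l.map Z).prod ∈ core K Z :=
  StarAlgebra.subset_adjoin ℂ _ ⟨l, hl, rfl⟩

lemma isMulCommutative_core (h : IsHalfLiberated K Z) : IsMulCommutative (core K Z) :=
  StarAlgebra.isMulCommutative_adjoin ℂ
    (by rintro _ ⟨l, hl, rfl⟩ _ ⟨l', hl', rfl⟩; exact h.commute l l' hl hl')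
    (by rintro _ ⟨l, hl, rfl⟩ _ ⟨l', hl', rfl⟩; exact h.commute_star l l' hl hl')

lemma mul_comm_of_mem_core (h : IsHalfLiberated K Z) {x y : E} (hx : x ∈ core K Z)
    (hy : y ∈ core K Z) : x * y = y * x := by
  have := h.isMulCommutative_core
  exact congrArg Subtype.val (mul_comm' (⟨x, hx⟩ : core K Z) ⟨y, hy⟩)

/-- Inserting ∑ w w* over the words of length K - 1 writes the product as a sum of terms (z_i w)(z_j
w)*, whose factors are words of length K and their adjoints. -/
lemma mul_star_mem_core (h : IsHalfLiberated K Z) (hK : 1 ≤ K) (i j : Fin N) :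
    Z i * star (Z j) ∈ core K Z := by
  refine mul_mem_of_words h.sum_mul_star (core K Z).toSubalgebra.toSubmodule.toAddSubmonoid
    _ _ (K - 1) fun l hl => ?_
  have : Z i * ((l.map Z).prod * star (l.map Z).prod) * star (Z j)
      = ((i :: l).map Z).prod * star ((j :: l).map Z).prod := by
    simp only [List.map_cons, List.prod_cons, star_mul, mul_assoc]
  rw [this]
  exact mul_mem (S := StarSubalgebra ℂ E) (word_mem_core (by simp; omega))
    (star_mem (word_mem_core (by simp; omega)))

lemma star_mul_mem_core (h : IsHalfLiberated K Z) (hK : 1 ≤ K) (i j : Fin N) :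
    star (Z i) * Z j ∈ core K Z := by
  refine mul_mem_of_star_words h.sum_star_mul (core K Z).toSubalgebra.toSubmodule.toAddSubmonoid
    _ _ (K - 1) fun l hl => ?_
  have : star (Z i) * (star (l.map Z).prod * (l.map Z).prod) * Z j
      = star ((l ++ [i]).map Z).prod * ((l ++ [j]).map Z).prod := by
    simp [star_mul, mul_assoc]
  rw [this]
  exact mul_mem (S := StarSubalgebra ℂ E) (star_mem (word_mem_core (by simp; omega)))
    (word_mem_core (by simp; omega))

/-- In z_k b z_k* z_i the factor z_k* z_i lies in the core, so it passes to the left of b, and ∑ z_k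
z_k* = 1 absorbs the sum. -/
lemma conjMap_mul_gen (h : IsHalfLiberated K Z) (hK : 1 ≤ K) {b : E} (hb : b ∈ core K Z)
    (i : Fin N) : conjMap Z b * Z i = Z i * b := by
  rw [conjMap_apply, Finset.sum_mul]
  calc ∑ k, Z k * b * star (Z k) * Z i = ∑ k, Z k * star (Z k) * (Z i * b) := by
        refine Finset.sum_congr rfl fun k _ => ?_
        rw [mul_assoc, mul_assoc, h.mul_comm_of_mem_core hb (h.star_mul_mem_core hK k i)]
        simp only [mul_assoc]
    _ = Z i * b := by rw [← Finset.sum_mul, h.sum_mul_star, one_mul]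

lemma conjMap_mul (h : IsHalfLiberated K Z) (hK : 1 ≤ K) {b : E} (hb : b ∈ core K Z) (c : E) :
    conjMap Z (b * c) = conjMap Z b * conjMap Z c := by
  rw [conjMap_apply, conjMap_apply c, Finset.mul_sum]
  refine Finset.sum_congr rfl fun k _ => ?_
  rw [← mul_assoc (Z k), ← h.conjMap_mul_gen hK hb]
  simp only [mul_assoc]

/-- On a word, the new letter z_k joins the front while the last letter z_m splits off as z_m z_k*:
the length stays K and both factors lie in the core. Multiplicativity extends this to the whole
core. -/
lemma conjMap_mem (h : IsHalfLiberated K Z) (hK : 1 ≤ K) {b : E} (hb : b ∈ core K Z) :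
    conjMap Z b ∈ core K Z := by
  induction hb using StarAlgebra.adjoin_induction with
  | mem x hx =>
    obtain ⟨l, hl, rfl⟩ := hx
    obtain rfl | ⟨l', m, rfl⟩ := l.eq_nil_or_concat'
    · simp at hl; omega
    rw [conjMap_apply]
    refine sum_mem fun k _ => ?_
    have : Z k * ((l' ++ [m]).map Z).prod * star (Z k)
        = ((k :: l').map Z).prod * (Z m * star (Z k)) := by
      simp [mul_assoc]
    rw [this]
    exact mul_mem (S := StarSubalgebra ℂ E) (word_mem_core (by simpa using hl))
      (h.mul_star_mem_core hK m k)
  | algebraMap c => rw [h.conjMap_algebraMap]; exact algebraMap_mem _ c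
  | add x y _ _ hx hy => rw [map_add]; exact add_mem hx hy
  | mul x y hx' _ hx hy => rw [h.conjMap_mul hK hx']; exact mul_mem hx hy
  | star x _ hx => rw [conjMap_star]; exact star_mem hx

lemma iterate_conjMap_mem (h : IsHalfLiberated K Z) (hK : 1 ≤ K) {b : E} (hb : b ∈ core K Z)
    (n : ℕ) : (conjMap Z)^[n] b ∈ core K Z := by
  induction n with
  | zero => exact hb
  | succ n ih => rw [Function.iterate_succ_apply']; exact h.conjMap_mem hK ih

lemma iterate_conjMap_mul_word (h : IsHalfLiberated K Z) (hK : 1 ≤ K) {b : E}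
    (hb : b ∈ core K Z) (l : List (Fin N)) :
    (conjMap Z)^[l.length] b * (l.map Z).prod = (l.map Z).prod * b := by
  induction l with
  | nil => simp
  | cons i l ih =>
    rw [List.length_cons, Function.iterate_succ_apply', List.map_cons, List.prod_cons, ← mul_assoc,
      h.conjMap_mul_gen hK (h.iterate_conjMap_mem hK hb _), mul_assoc, ih, mul_assoc]

/-- Moving b past a word w of length K gives σ^K(b) w = w b, and w b = b w since w is in the core.
So σ^K(b) - b kills every w on the left, hence also ∑ w w* = 1. -/
lemma iterate_conjMap_eq_self (h : IsHalfLiberated K Z) (hK : 1 ≤ K) {b : E}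
    (hb : b ∈ core K Z) : (conjMap Z)^[K] b = b := by
  have := mul_mem_of_words h.sum_mul_star (⊥ : AddSubmonoid E) ((conjMap Z)^[K] b - b) 1 K
    fun l hl => by
      have h1 := h.iterate_conjMap_mul_word hK hb l
      rw [hl, h.mul_comm_of_mem_core (word_mem_core hl) hb] at h1
      rw [← mul_assoc, sub_mul, h1, sub_self, zero_mul, zero_mul]
      exact zero_mem _
  rwa [AddSubmonoid.mem_bot, mul_one, sub_eq_zero] at this

/-- Elements of the core can be moved past the generators from left to right. -/
lemma exists_mul_gen_eq (h : IsHalfLiberated K Z) (hK : 1 ≤ K) {b : E} (hb : b ∈ core K Z) :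
    ∃ b' ∈ core K Z, ∀ i, b * Z i = Z i * b' := by
  obtain ⟨n, rfl⟩ := Nat.exists_eq_add_of_le' hK
  -- As σ^K = id, σ^(K-1) inverts σ on the core.
  refine ⟨(conjMap Z)^[n] b, h.iterate_conjMap_mem hK hb n, fun i => ?_⟩
  rw [← h.conjMap_mul_gen hK (h.iterate_conjMap_mem hK hb n), ← Function.iterate_succ_apply' (conjMap Z),
    h.iterate_conjMap_eq_self hK hb]

/-- The restriction of `conjMap` to the core. -/
noncomputable def coreHom (h : IsHalfLiberated K Z) (hK : 1 ≤ K) : core K Z →+* core K Z where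
  toFun b := ⟨conjMap Z b, h.conjMap_mem hK b.2⟩
  map_one' := Subtype.ext (by simpa using h.conjMap_algebraMap 1)
  map_mul' b c := Subtype.ext (h.conjMap_mul hK b.2 c)
  map_zero' := Subtype.ext (by simp)
  map_add' b c := Subtype.ext (by simp)

lemma coe_iterate_coreHom (h : IsHalfLiberated K Z) (hK : 1 ≤ K) (b : core K Z) (n : ℕ) :
    (((h.coreHom hK)^[n] b : core K Z) : E) = (conjMap Z)^[n] b := by
  induction n with
  | zero => rfl
  | succ n ih =>
    rw [Function.iterate_succ_apply', Function.iterate_succ_apply', ← ih]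
    rfl

/-- Applied to a fixed element and to its adjoint, this supplies the hypotheses of Schur's lemma. -/
lemma commute_gen_of_conjMap_eq (h : IsHalfLiberated K Z) (hK : 1 ≤ K) {b : E}
    (hb : b ∈ core K Z) (hfix : conjMap Z b = b) (i : Fin N) : Commute b (Z i) := by
  have := h.conjMap_mul_gen hK hb i
  rwa [hfix] at this

end IsHalfLiberated

/-! ### Periodic orbits and algebraicity -/

open Polynomial in
/-- If the orbit of `b` under `σ` is periodic then `b` is a root of a monic polynomial with
`σ`-invariant coefficients. -/
lemma exists_monic_eval_eq_zero_of_iterate_eq {R : Type*} [CommRing R] (σ : R →+* R) (b : R)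
    {K : ℕ} (hK : 1 ≤ K) (hb : σ^[K] b = b) :
    ∃ P : R[X], P.Monic ∧ P.eval b = 0 ∧ ∀ n, σ (P.coeff n) = P.coeff n := by
  obtain ⟨n, rfl⟩ := Nat.exists_eq_add_of_le' hK
  set P : R[X] := ∏ k ∈ Finset.range (n + 1), (X - C (σ^[k] b)) with hP
  -- σ permutes the factors cyclically: it sends the last one, k = n, to the first because σ^(n+1) b
  -- = b.
  have hmap : P.map σ = P := by
    rw [hP, Polynomial.map_prod]
    conv_lhs => rw [Finset.prod_range_succ]
    conv_rhs => rw [Finset.prod_range_succ']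
    simp only [Polynomial.map_sub, map_X, map_C, ← Function.iterate_succ_apply', hb,
      Function.iterate_zero, id]
  refine ⟨P, monic_prod_of_monic _ _ fun k _ => monic_X_sub_C _, ?_, fun m => ?_⟩
  · rw [hP, eval_prod]
    exact Finset.prod_eq_zero (Finset.mem_range.2 n.succ_pos) (by simp)
  · conv_rhs => rw [← hmap, coeff_map]

/-! ### Joint eigenvectors -/

section Eigenvectors

open Polynomial

variable {V : Type*} [AddCommGroup V] [Module ℂ V]

/-- Split linear factors off p until the remaining factor q no longer kills v; the last factor X - c
removed shows that q(T) v is an eigenvector. No finiteness of V is needed. -/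
lemma exists_aeval_apply_eigenvector (T : Module.End ℂ V) (v : V) (hv : v ≠ 0) (p : ℂ[X])
    (hp : p ≠ 0) (hpv : aeval T p v = 0) :
    ∃ (q : ℂ[X]) (c : ℂ), aeval T q v ≠ 0 ∧ T (aeval T q v) = c • aeval T q v := by
  induction hn : p.natDegree using Nat.strong_induction_on generalizing p with
  | _ n ih =>
    by_cases h0 : p.degree = 0
    · rw [eq_C_of_degree_eq_zero h0, aeval_C] at hpv
      have hc : p.coeff 0 ≠ 0 := fun h => hp (by rw [eq_C_of_degree_eq_zero h0, h, C_0])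
      rw [Module.algebraMap_end_apply] at hpv
      exact absurd hpv (smul_ne_zero hc hv)
    · obtain ⟨c, hc⟩ := IsAlgClosed.exists_root p h0
      obtain ⟨q, rfl⟩ := dvd_iff_isRoot.2 hc
      have hq : q ≠ 0 := right_ne_zero_of_mul hp
      by_cases hqv : aeval T q v = 0
      · refine ih q.natDegree ?_ q hq hqv rfl
        rw [← hn, natDegree_mul (X_sub_C_ne_zero c) hq, natDegree_X_sub_C]
        omega
      · refine ⟨q, c, hqv, ?_⟩
        rw [map_mul, Module.End.mul_apply, map_sub, aeval_X, aeval_C, LinearMap.sub_apply,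
          Module.algebraMap_end_apply, sub_eq_zero] at hpv
        exact hpv

/-- Finitely many commuting algebraic endomorphisms have a joint eigenvector. -/
lemma exists_joint_eigenvector [Nontrivial V] {ι : Type*} (T : ι → Module.End ℂ V)
    (hcomm : ∀ i j, Commute (T i) (T j)) (halg : ∀ i, IsAlgebraic ℂ (T i)) (s : Finset ι) :
    ∃ v ≠ 0, ∀ i ∈ s, ∃ c : ℂ, T i v = c • v := by
  classical
  induction s using Finset.induction_on with
  | empty =>
    obtain ⟨v, hv⟩ := exists_ne (0 : V)
    exact ⟨v, hv, by simp⟩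
  | insert a s _ ih =>
    obtain ⟨v, hv, hs⟩ := ih
    obtain ⟨p, hp, hpT⟩ := halg a
    obtain ⟨q, c, hq, hqc⟩ := exists_aeval_apply_eigenvector (T a) v hv p hp (by rw [hpT]; rfl)
    refine ⟨aeval (T a) q v, hq, fun i hi => ?_⟩
    obtain rfl | hi := Finset.mem_insert.1 hi
    · exact ⟨c, hqc⟩
    · obtain ⟨d, hd⟩ := hs i hi
      refine ⟨d, ?_⟩
      -- The new vector is a polynomial in `T a` applied to v, so operators commuting with `T a`
      -- keep their eigenvalues on it.
      have hc : Commute (T i) (aeval (T a) q) := by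
        rw [aeval_eq_sum_range]
        exact Commute.sum_right _ _ _ fun k _ => ((hcomm i a).pow_right k).smul_right _
      rw [← Module.End.mul_apply, hc.eq, Module.End.mul_apply, hd, map_smul]

end Eigenvectors

/-! ### Irreducible families of operators -/

section Irreducible

variable {H : Type*} [NormedAddCommGroup H] [InnerProductSpace ℂ H]
  [CompleteSpace H] {ι : Type*}

/-- A family of operators is irreducible if no closed subspace other than `0` and `H` is invariant
under the family and its adjoints. -/
def IsIrreducibleFamily (Z : ι → H →L[ℂ] H) : Prop :=
  ∀ W : Submodule ℂ H, IsClosed (W : Set H) →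
    (∀ i, ∀ v ∈ W, Z i v ∈ W ∧ star (Z i) v ∈ W) → W = ⊥ ∨ W = ⊤

variable {Z : ι → H →L[ℂ] H}

/-- The kernel of f is closed and invariant, and it contains the range of g. -/
lemma IsIrreducibleFamily.eq_zero_or_eq_zero_of_mul_eq_zero (hZ : IsIrreducibleFamily Z)
    {f g : H →L[ℂ] H} (hf : ∀ i, Commute f (Z i)) (hf' : ∀ i, Commute f (star (Z i)))
    (hfg : f * g = 0) : f = 0 ∨ g = 0 := by
  have hinv : ∀ i, ∀ v ∈ LinearMap.ker (f : H →ₗ[ℂ] H),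
      Z i v ∈ LinearMap.ker (f : H →ₗ[ℂ] H) ∧ star (Z i) v ∈ LinearMap.ker (f : H →ₗ[ℂ] H) := by
    intro i v hv
    have hv' : f v = 0 := hv
    have key : ∀ x : H →L[ℂ] H, Commute f x → f (x v) = 0 := fun x hx => by
      rw [← mul_apply_eq_comp, hx.eq, mul_apply_eq_comp, hv', map_zero]
    exact ⟨key _ (hf i), key _ (hf' i)⟩
  rcases hZ _ f.isClosed_ker hinv with h | h
  · refine Or.inr (ContinuousLinearMap.ext fun v => ?_)
    have : g v ∈ LinearMap.ker (f : H →ₗ[ℂ] H) := DFunLike.congr_fun hfg v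
    rw [h] at this
    exact this
  · refine Or.inl (ContinuousLinearMap.ext fun v => ?_)
    have : v ∈ LinearMap.ker (f : H →ₗ[ℂ] H) := h ▸ Submodule.mem_top
    exact this

/-- Two spectral points could be separated at their midpoint m: the positive parts of a - m and m -
a have product zero, yet neither vanishes. -/
lemma IsIrreducibleFamily.exists_eq_algebraMap_of_isSelfAdjoint (hZ : IsIrreducibleFamily Z)
    {a : H →L[ℂ] H} (ha : IsSelfAdjoint a) (hc : ∀ i, Commute a (Z i)) :
    ∃ c : ℝ, a = algebraMap ℝ _ c := by
  have hc' : ∀ i, Commute a (star (Z i)) := fun i => by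
    have := (hc i).star_star
    rwa [ha.star_eq] at this
  have hsub : (spectrum ℝ a).Subsingleton := by
    intro x hx y hy
    by_contra hxy
    wlog hlt : x < y generalizing x y
    · exact this hy hx (Ne.symm hxy) (lt_of_le_of_ne (not_lt.1 hlt) (Ne.symm hxy))
    set m := (x + y) / 2 with hm
    have hfg : cfc (fun r : ℝ => max 0 (r - m)) a * cfc (fun r : ℝ => max 0 (m - r)) a = 0 := by
      rw [← cfc_mul _ _ a, ← cfc_zero ℝ a]
      refine cfc_congr fun r _ => ?_
      rcases le_total r m with h | h
      · simp [max_eq_left (sub_nonpos.2 h)]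
      · simp [max_eq_left (sub_nonpos.2 h)]
    rcases hZ.eq_zero_or_eq_zero_of_mul_eq_zero (fun i => (hc i).cfc_real _)
      (fun i => (hc' i).cfc_real _) hfg with h | h
    · rw [← cfc_zero ℝ a, cfc_eq_cfc_iff_eqOn] at h
      have := h hy
      simp only [Pi.zero_apply, max_eq_left_iff] at this
      linarith
    · rw [← cfc_zero ℝ a, cfc_eq_cfc_iff_eqOn] at h
      have := h hx
      simp only [Pi.zero_apply, max_eq_left_iff] at this
      linarith
  obtain h | ⟨c, h⟩ := hsub.eq_empty_or_singleton
  -- Empty spectrum, which occurs only for H = 0; any scalar would do.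
  · exact ⟨0, CFC.eq_algebraMap_of_spectrum_subset_singleton a 0 (by simp [h]) ha⟩
  · exact ⟨c, CFC.eq_algebraMap_of_spectrum_subset_singleton a c h.le ha⟩

/-- Schur's lemma. -/
lemma IsIrreducibleFamily.exists_eq_algebraMap (hZ : IsIrreducibleFamily Z)
    {a : H →L[ℂ] H} (hc : ∀ i, Commute a (Z i)) (hc' : ∀ i, Commute (star a) (Z i)) :
    ∃ c : ℂ, a = algebraMap ℂ _ c := by
  have hre : ∀ i, Commute (realPart a : H →L[ℂ] H) (Z i) := fun i => by
    rw [realPart_apply_coe]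
    exact ((hc i).add_left (hc' i)).smul_left _
  have him : ∀ i, Commute (imaginaryPart a : H →L[ℂ] H) (Z i) := fun i => by
    rw [imaginaryPart_apply_coe]
    exact (((hc i).sub_left (hc' i)).smul_left _).smul_left _
  obtain ⟨x, hx⟩ := hZ.exists_eq_algebraMap_of_isSelfAdjoint (realPart a).2 hre
  obtain ⟨y, hy⟩ := hZ.exists_eq_algebraMap_of_isSelfAdjoint (imaginaryPart a).2 him
  refine ⟨x + Complex.I * y, ?_⟩
  rw [← realPart_add_I_smul_imaginaryPart a, hx, hy]
  simp only [Algebra.algebraMap_eq_smul_one, add_smul, mul_smul]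
  rfl

end Irreducible

/-! ### The dimension bound for irreducible families -/

namespace IsHalfLiberated

variable {N K : ℕ} {H : Type*} [NormedAddCommGroup H] [InnerProductSpace ℂ H] [CompleteSpace H]
  {Z : Fin N → H →L[ℂ] H}

/-- The σ-orbit of b has period K, so b is a root of a monic polynomial with σ-fixed coefficients,
and these are scalars by Schur's lemma. -/
lemma isAlgebraic_of_mem_core (h : IsHalfLiberated K Z) (hK : 1 ≤ K) [Nontrivial H]
    (hZ : IsIrreducibleFamily Z) {b : H →L[ℂ] H} (hb : b ∈ core K Z) : IsAlgebraic ℂ b := by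
  let _ : CommRing (core K Z) :=
    { (inferInstance : Ring (core K Z)) with
      mul_comm := fun x y => Subtype.ext (h.mul_comm_of_mem_core x.2 y.2) }
  obtain ⟨P, hP, hPb, hfix⟩ := exists_monic_eval_eq_zero_of_iterate_eq (h.coreHom hK) ⟨b, hb⟩ hK
    (Subtype.ext (by rw [h.coe_iterate_coreHom]; exact h.iterate_conjMap_eq_self hK hb))
  have hscalar : ∀ n, ∃ c : ℂ, (P.coeff n : H →L[ℂ] H) = algebraMap ℂ _ c := fun n => by
    have h1 : conjMap Z (P.coeff n : H →L[ℂ] H) = P.coeff n := congrArg Subtype.val (hfix n)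
    refine hZ.exists_eq_algebraMap (h.commute_gen_of_conjMap_eq hK (P.coeff n).2 h1)
      (h.commute_gen_of_conjMap_eq hK (star_mem (P.coeff n).2) ?_)
    rw [conjMap_star, h1]
  choose c hc using hscalar
  refine ⟨∑ n ∈ Finset.range (P.natDegree + 1), Polynomial.monomial n (c n), fun h0 => ?_, ?_⟩
  · have h1 := congrArg (Polynomial.coeff · P.natDegree) h0
    simp only [Polynomial.finsetSum_coeff, Polynomial.coeff_monomial, Finset.sum_ite_eq',
      Finset.mem_range, Nat.lt_succ_self, if_true, Polynomial.coeff_zero] at h1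
    have h2 := hc P.natDegree
    rw [h1, map_zero, Polynomial.coeff_natDegree, hP.leadingCoeff] at h2
    exact one_ne_zero h2
  · have h1 := congrArg (Subtype.val : core K Z → H →L[ℂ] H) hPb
    rw [Polynomial.eval_eq_sum_range] at h1
    rw [map_sum]
    simp only [Polynomial.aeval_monomial, ← hc]
    rw [ZeroMemClass.coe_zero] at h1
    rw [← h1, AddSubmonoidClass.coe_finsetSum]
    rfl

/-- A joint eigenvector of the core. -/
def IsCoreEigenvector (K : ℕ) (Z : Fin N → H →L[ℂ] H) (v : H) : Prop :=
  ∀ b ∈ core K Z, ∃ c : ℂ, b v = c • v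

/-- The core is generated by finitely many commuting algebraic operators, the words of length K and
their adjoints; a joint eigenvector of these is one for everything they generate. -/
lemma exists_isCoreEigenvector (h : IsHalfLiberated K Z) (hK : 1 ≤ K) [Nontrivial H]
    (hZ : IsIrreducibleFamily Z) : ∃ v ≠ 0, IsCoreEigenvector K Z v := by
  let S : (Fin K → Fin N) × Bool → H →L[ℂ] H := fun x =>
    if x.2 then ((List.ofFn x.1).map Z).prod else star ((List.ofFn x.1).map Z).prod
  have hS : ∀ x, S x ∈ core K Z := fun x => by
    have hw : ((List.ofFn x.1).map Z).prod ∈ core K Z := word_mem_core (List.length_ofFn)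
    dsimp only [S]
    split_ifs
    exacts [hw, star_mem hw]
  let ρ : (H →L[ℂ] H) →ₐ[ℂ] Module.End ℂ H :=
    { toFun := fun T => T
      map_one' := rfl
      map_mul' := fun _ _ => rfl
      map_zero' := rfl
      map_add' := fun _ _ => rfl
      commutes' := fun _ => rfl }
  obtain ⟨v, hv, hT⟩ := exists_joint_eigenvector (fun x => ρ (S x))
    (fun x y => (show Commute (S x) (S y) from h.mul_comm_of_mem_core (hS x) (hS y)).map ρ)
    (fun x => (h.isAlgebraic_of_mem_core hK hZ (hS x)).algHom _) Finset.univ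
  have key : ∀ x, ∃ c : ℂ, S x v = c • v := fun x => hT x (Finset.mem_univ x)
  refine ⟨v, hv, fun b hb => ?_⟩
  have hb' : b ∈ Algebra.adjoin ℂ (words K Z ∪ star (words K Z)) := by
    rw [← StarAlgebra.adjoin_toSubalgebra]
    exact hb
  have hof : ∀ l : List (Fin N), l.length = K → ∃ f : Fin K → Fin N, List.ofFn f = l := by
    rintro l rfl
    exact ⟨l.get, List.ofFn_get l⟩
  clear hb
  induction hb' using Algebra.adjoin_induction with
  | mem x hx =>
    rcases hx with ⟨l, hl, rfl⟩ | ⟨l, hl, hx⟩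
    · obtain ⟨f, rfl⟩ := hof l hl
      exact key (f, true)
    · obtain ⟨f, rfl⟩ := hof l hl
      rw [← star_star x, ← hx]
      exact key (f, false)
  | algebraMap r => exact ⟨r, by simp [Algebra.algebraMap_eq_smul_one]⟩
  | add x y _ _ hx hy =>
    obtain ⟨c, hc⟩ := hx
    obtain ⟨d, hd⟩ := hy
    exact ⟨c + d, by rw [add_apply, hc, hd, add_smul]⟩
  | mul x y _ _ hx hy =>
    obtain ⟨c, hc⟩ := hx
    obtain ⟨d, hd⟩ := hy
    exact ⟨d * c, by rw [mul_apply_eq_comp, hd, map_smul, hc, mul_smul]⟩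

/-- Some z_m v is nonzero because ∑ z_i* z_i = 1. It is a core eigenvector since b z_m = z_m b'. Now
z_m* z_m v = c v with c ≠ 0, so z_l v is a multiple of (z_l z_m*) z_m v, where z_l z_m* is in the
core: all the z_l v lie on one line. -/
lemma exists_next (h : IsHalfLiberated K Z) (hK : 1 ≤ K) {v : H} (hv0 : v ≠ 0)
    (hv : IsCoreEigenvector K Z v) :
    ∃ m, Z m v ≠ 0 ∧ IsCoreEigenvector K Z (Z m v) ∧ (∀ l, ∃ c : ℂ, Z l v = c • Z m v) ∧
      ∀ l, ∃ c : ℂ, star (Z l) (Z m v) = c • v := by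
  obtain ⟨m, hm⟩ : ∃ m, Z m v ≠ 0 := by
    by_contra! hall
    refine hv0 ?_
    have : (∑ i, star (Z i) * Z i) v = 0 := by
      simp [hall]
    rwa [h.sum_star_mul] at this
  have heig : IsCoreEigenvector K Z (Z m v) := fun b hb => by
    obtain ⟨b', hb', hbb'⟩ := h.exists_mul_gen_eq hK hb
    obtain ⟨c, hc⟩ := hv b' hb'
    refine ⟨c, ?_⟩
    rw [← mul_apply_eq_comp, hbb', mul_apply_eq_comp, hc, map_smul]
  have hstar : ∀ l, ∃ c : ℂ, star (Z l) (Z m v) = c • v := fun l =>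
    hv _ (h.star_mul_mem_core hK l m)
  refine ⟨m, hm, heig, fun l => ?_, hstar⟩
  obtain ⟨c, hc⟩ := hstar m
  obtain ⟨d, hd⟩ := heig _ (h.mul_star_mem_core hK l m)
  have hc0 : c ≠ 0 := by
    rintro rfl
    rw [zero_smul] at hc
    refine hm ?_
    have : inner ℂ (Z m v) (Z m v) = 0 := by
      rw [← ContinuousLinearMap.adjoint_inner_right, ← ContinuousLinearMap.star_eq_adjoint, hc,
        inner_zero_right]
    exact inner_self_eq_zero.1 this
  rw [mul_apply_eq_comp, hc, map_smul] at hd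
  exact ⟨c⁻¹ * d, by rw [mul_smul, ← hd, inv_smul_smul₀ hc0]⟩

theorem finrank_le (h : IsHalfLiberated K Z) (hK : 1 ≤ K) [Nontrivial H]
    (hZ : IsIrreducibleFamily Z) : FiniteDimensional ℂ H ∧ Module.finrank ℂ H ≤ K := by
  classical
  obtain ⟨v, hv0, hv⟩ := h.exists_isCoreEigenvector hK hZ
  let V := {w : H // w ≠ 0 ∧ IsCoreEigenvector K Z w}
  choose m hm using fun w : V => h.exists_next hK w.2.1 w.2.2
  let next : V → V := fun w => ⟨Z (m w) w, (hm w).1, (hm w).2.1⟩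
  let η : ℕ → V := fun n => next^[n] ⟨v, hv0, hv⟩
  have hη : ∀ n, (η (n + 1) : H) = Z (m (η n)) (η n) := fun n => by
    simp only [η, Function.iterate_succ_apply']
    rfl
  have hup : ∀ n l, ∃ c : ℂ, Z l (η n) = c • (η (n + 1) : H) := fun n l => by
    rw [hη]; exact (hm (η n)).2.2.1 l
  have hdown : ∀ n l, ∃ c : ℂ, star (Z l) (η (n + 1)) = c • (η n : H) := fun n l => by
    rw [hη]; exact (hm (η n)).2.2.2 l
  have hword : ∀ n, ∃ l : List (Fin N), l.length = n ∧ (η n : H) = (l.map Z).prod (η 0 : H) := by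
    intro n
    induction n with
    | zero => exact ⟨[], rfl, rfl⟩
    | succ n ih =>
      obtain ⟨l, hl, hln⟩ := ih
      refine ⟨m (η n) :: l, by simp [hl], ?_⟩
      rw [hη, List.map_cons, List.prod_cons, mul_apply_eq_comp, ← hln]
  -- The chain closes up: η_K is a word of length K, an element of the core, applied to the core
  -- eigenvector η₀.
  obtain ⟨c, hc⟩ : ∃ c : ℂ, (η K : H) = c • (η 0 : H) := by
    obtain ⟨l, hl, hln⟩ := hword K
    obtain ⟨c, hc⟩ := (η 0).2.2 _ (word_mem_core hl)
    exact ⟨c, hln.trans hc⟩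
  have hc0 : c ≠ 0 := fun h0 => (η K).2.1 (by rw [hc, h0, zero_smul])
  let g : Fin K → H := fun k => η k
  let W := Submodule.span ℂ (Set.range g)
  have hmem : ∀ n ≤ K, (η n : H) ∈ W := fun n hn => by
    rcases hn.lt_or_eq with hn | rfl
    · exact Submodule.subset_span ⟨⟨n, hn⟩, rfl⟩
    · rw [hc]
      exact W.smul_mem _ (Submodule.subset_span ⟨⟨0, hK⟩, rfl⟩)
  have hinv : ∀ T : H →L[ℂ] H, (∀ k < K, T (η k) ∈ W) → ∀ w ∈ W, T w ∈ W := by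
    intro T hT w hw
    have : W ≤ W.comap (T : H →ₗ[ℂ] H) := by
      refine Submodule.span_le.2 ?_
      rintro _ ⟨k, rfl⟩
      exact hT k k.2
    exact this hw
  have hfin : FiniteDimensional ℂ W := FiniteDimensional.span_of_finite ℂ (Set.finite_range g)
  have htop : W = ⊤ := by
    refine (hZ W W.closed_of_finiteDimensional fun i w hw => ⟨?_, ?_⟩).resolve_left fun hbot => ?_
    · refine hinv _ (fun k hk => ?_) w hw
      obtain ⟨c, hc⟩ := hup k i
      rw [hc]
      exact W.smul_mem _ (hmem _ hk)
    · refine hinv _ (fun k hk => ?_) w hw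
      have hpos : ∀ n < K, star (Z i) (η (n + 1)) ∈ W := fun n hn => by
        obtain ⟨d, hd⟩ := hdown n i
        rw [hd]
        exact W.smul_mem _ (hmem _ hn.le)
      rcases k with _ | n
      -- The vector η₀ has no predecessor in the chain, but it is proportional to η_K, whose
      -- predecessor is η_(K-1).
      · have h1 := hpos (K - 1) (by omega)
        rw [Nat.sub_add_cancel hK, hc, map_smul] at h1
        exact (W.smul_mem_iff hc0).1 h1
      · exact hpos n (by omega)
    · have := hmem 0 (Nat.zero_le _)
      rw [hbot] at this
      exact hv0 this
  have hle : Module.finrank ℂ W ≤ K := by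
    have := finrank_range_le_card (R := ℂ) g
    rwa [Fintype.card_fin] at this
  rw [htop] at hfin hle
  rw [finrank_top] at hle
  exact ⟨Module.finite_def.2 (Module.Finite.iff_fg.1 hfin), hle⟩

end IsHalfLiberated

/-! ### The universal property -/

namespace StarPoly

variable {N : ℕ} {E : Type*} [Ring E] [StarRing E]

/-- The value of a letter when `zᵢ` is replaced by `Z i`. -/
def letterEval (Z : Fin N → E) (x : Fin N × Bool) : E := if x.2 then Z x.1 else star (Z x.1)

lemma lift_letterEval_adj (Z : Fin N → E) (w : StarWord N) :
    FreeMonoid.lift (letterEval Z) w.adj = star (FreeMonoid.lift (letterEval Z) w) := by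
  induction w using FreeMonoid.inductionOn' with
  | one => simp [StarWord.adj]
  | of_mul x w ih =>
    have hx : StarWord.adj (FreeMonoid.of x) = FreeMonoid.of (x.1, !x.2) := rfl
    rw [StarWord.adj_mul, map_mul, map_mul, star_mul, ih, hx, FreeMonoid.lift_eval_of,
      FreeMonoid.lift_eval_of]
    obtain ⟨i, _ | _⟩ := x <;> simp [letterEval]

variable [Algebra ℂ E]

/-- Evaluation of polynomials as an algebra morphism. -/
noncomputable def evalAlgHom (Z : Fin N → E) : StarPoly N →ₐ[ℂ] E :=
  MonoidAlgebra.lift ℂ E (StarWord N) (FreeMonoid.lift (letterEval Z))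

lemma evalAlgHom_monomial (Z : Fin N → E) (w : StarWord N) (c : ℂ) :
    evalAlgHom Z (monomial w c) = c • FreeMonoid.lift (letterEval Z) w :=
  MonoidAlgebra.lift_single ..

variable [StarModule ℂ E]

/-- Evaluation of noncommutative `*`-polynomials at a family. -/
noncomputable def eval (Z : Fin N → E) : StarPoly N →⋆ₐ[ℂ] E :=
  { evalAlgHom Z with
    map_star' := fun f => by
      show evalAlgHom Z (adj f) = star (evalAlgHom Z f)
      induction f using induction_monomial with
      | zero => simp [adj_zero]
      | add f g hf hg => rw [adj_add, map_add, map_add, star_add, hf, hg]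
      | mono w c =>
        rw [adj_monomial, evalAlgHom_monomial, evalAlgHom_monomial, lift_letterEval_adj, star_smul]
        rfl }

lemma eval_z (Z : Fin N → E) (i : Fin N) : eval Z (z i) = Z i := by
  show evalAlgHom Z (monomial _ 1) = _
  rw [evalAlgHom_monomial, one_smul, FreeMonoid.lift_eval_of]
  rfl

/-- A subalgebra closed under `star` containing the coordinates is everything. -/
lemma mem_of_z_mem (S : Subalgebra ℂ (StarPoly N)) (h : ∀ i, z i ∈ S) (h' : ∀ i, star (z i) ∈ S)
    (f : StarPoly N) : f ∈ S := by
  induction f using induction_monomial with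
  | zero => exact S.zero_mem
  | add f g hf hg => exact S.add_mem hf hg
  | mono w c =>
    rw [← mul_one c, ← smul_monomial]
    refine S.smul_mem ?_ c
    induction w using FreeMonoid.inductionOn' with
    | one => exact S.one_mem
    | of_mul x w ih =>
      rw [← mul_one (1 : ℂ), ← monomial_mul]
      refine S.mul_mem ?_ ih
      obtain ⟨i, _ | _⟩ := x
      · rw [← star_z]; exact h' i
      · exact h i

end StarPoly

namespace SphereCStar

open FreeSphere

variable {N : ℕ} {R : Set (StarPoly N)} {E : Type*} [CStarAlgebra E]

/-- The canonical morphism to the universal `C*`-algebra. -/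
noncomputable def mk (R : Set (StarPoly N)) : StarPoly N →⋆ₐ[ℂ] SphereCStar R :=
  CStarSeminorm.Compl.ofHom (maxSeminorm R)

lemma denseRange_mk : DenseRange (mk R) := CStarSeminorm.Compl.denseRange_of (maxSeminorm R)

lemma norm_mk (x : StarPoly N) : ‖mk R x‖ = ⨆ p : Admissible R, p.1 x :=
  CStarSeminorm.Compl.norm_of (maxSeminorm R) x

lemma mk_eq_zero {r : StarPoly N} (hr : r ∈ sphereRelators N ∪ R) : mk R r = 0 := by
  rw [← norm_eq_zero, norm_mk]
  simp [fun p : Admissible R => p.2 r hr]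

/-- The admissible seminorm of a representation of the relations. -/
noncomputable def pullbackSeminorm (φ : StarPoly N →⋆ₐ[ℂ] E)
    (hφ : ∀ r ∈ sphereRelators N ∪ R, φ r = 0) : Admissible R :=
  ⟨{ toSeminorm := (normSeminorm ℂ E).comp (φ : StarPoly N →ₐ[ℂ] E).toLinearMap
     mul_le' := fun x y => by
      show ‖φ (x * y)‖ ≤ ‖φ x‖ * ‖φ y‖
      rw [map_mul]
      exact norm_mul_le _ _
     star_mul_self' := fun x => by
      show ‖φ (star x * x)‖ = ‖φ x‖ ^ 2
      rw [map_mul, map_star, CStarRing.norm_star_mul_self, sq] },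
    fun r hr => by
      show ‖φ r‖ = 0
      rw [hφ r hr, norm_zero]⟩

/-- The pulled-back norm is one of the seminorms in the supremum defining the norm on the right. -/
lemma norm_le_norm_mk (φ : StarPoly N →⋆ₐ[ℂ] E) (hφ : ∀ r ∈ sphereRelators N ∪ R, φ r = 0)
    (x : StarPoly N) : ‖φ x‖ ≤ ‖mk R x‖ := by
  rw [norm_mk]
  exact le_ciSup (bddAbove_seminorms R x) (pullbackSeminorm φ hφ)

/-- The extension of a representation of the relations to the completion, as a ring morphism. -/
noncomputable def liftRingHom (φ : StarPoly N →⋆ₐ[ℂ] E)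
    (hφ : ∀ r ∈ sphereRelators N ∪ R, φ r = 0) : SphereCStar R →+* E :=
  UniformSpace.Completion.extensionHom (α := (maxSeminorm R).Pre)
    ((φ : StarPoly N →ₐ[ℂ] E) : StarPoly N →+* E)
    (AddMonoidHomClass.continuous_of_bound (𝓕 := (maxSeminorm R).Pre →+* E) _ 1 fun x => by
      rw [one_mul]
      exact (norm_le_norm_mk φ hφ x).trans_eq (CStarSeminorm.Compl.norm_of (maxSeminorm R) x))

lemma liftRingHom_mk (φ : StarPoly N →⋆ₐ[ℂ] E) (hφ : ∀ r ∈ sphereRelators N ∪ R, φ r = 0)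
    (x : StarPoly N) : liftRingHom φ hφ (mk R x) = φ x :=
  UniformSpace.Completion.extensionHom_coe (α := (maxSeminorm R).Pre) _ _ _

lemma continuous_liftRingHom (φ : StarPoly N →⋆ₐ[ℂ] E)
    (hφ : ∀ r ∈ sphereRelators N ∪ R, φ r = 0) : Continuous (liftRingHom φ hφ) :=
  UniformSpace.Completion.continuous_extension

/-- The universal property of `SphereCStar R`. -/
noncomputable def lift (φ : StarPoly N →⋆ₐ[ℂ] E) (hφ : ∀ r ∈ sphereRelators N ∪ R, φ r = 0) :
    SphereCStar R →⋆ₐ[ℂ] E :=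
  { liftRingHom φ hφ with
    commutes' := fun c => by
      show liftRingHom φ hφ _ = _
      rw [← AlgHomClass.commutes (mk R) c, liftRingHom_mk, AlgHomClass.commutes]
    map_star' := fun x => by
      show liftRingHom φ hφ (star x) = star (liftRingHom φ hφ x)
      refine isClosed_property (denseRange_mk (R := R))
        (isClosed_eq ((continuous_liftRingHom φ hφ).comp continuous_star)
          (continuous_star.comp (continuous_liftRingHom φ hφ))) (fun y => ?_) x
      rw [Function.comp_apply, Function.comp_apply, ← map_star, liftRingHom_mk, liftRingHom_mk,
        map_star] }

lemma lift_mk (φ : StarPoly N →⋆ₐ[ℂ] E) (hφ : ∀ r ∈ sphereRelators N ∪ R, φ r = 0)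
    (x : StarPoly N) : lift φ hφ (mk R x) = φ x :=
  liftRingHom_mk φ hφ x

end SphereCStar

/-! ### From irreducible representations to irreducible families -/

namespace HalfLiberatedSphere

open FreeSphere StarPoly

variable {N K : ℕ}

/-- The images of the coordinates satisfy the half-liberated relations. -/
lemma isHalfLiberated_map {E : Type*} [CStarAlgebra E] (π : HalfLiberatedSphere N K →⋆ₐ[ℂ] E) :
    IsHalfLiberated K fun i => π (SphereCStar.mk _ (z i)) := by
  let φ : StarPoly N →⋆ₐ[ℂ] E := π.comp (SphereCStar.mk _)
  have hφ : ∀ r ∈ sphereRelators N ∪ halfLiberatedRelators N K, φ r = 0 := fun r hr => by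
    show π (SphereCStar.mk _ r) = 0
    rw [SphereCStar.mk_eq_zero hr, map_zero]
  show IsHalfLiberated K fun i => φ (z i)
  have hword : ∀ f : Fin K → Fin N, ((List.ofFn f).map fun i => φ (z i)).prod = φ (zProd f) :=
    fun f => by
      rw [zProd, map_list_prod, List.map_ofFn, List.map_ofFn]
      rfl
  have hstar : ∀ l : List (Fin N), star (l.map fun i => φ (z i)).prod
      = (l.reverse.map fun i => φ (star (z i))).prod := fun l => by
    induction l with
    | nil => simp
    | cons i l ih => simp [ih, map_star φ]
  have hcomm : ∀ x y : StarPoly N, φ ⁅x, y⁆ = 0 → Commute (φ x) (φ y) := fun x y h => by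
    rwa [Ring.lie_def, map_sub, map_mul, map_mul, sub_eq_zero] at h
  have hof : ∀ l : List (Fin N), l.length = K → ∃ f : Fin K → Fin N, l = List.ofFn f := by
    rintro l rfl
    exact ⟨l.get, (List.ofFn_get l).symm⟩
  refine ⟨?_, ?_, fun l l' hl hl' => ?_, fun l l' hl hl' => ?_⟩
  · have := hφ _ (Or.inl (Or.inl rfl))
    simpa [sub_eq_zero, map_star φ] using this
  · have := hφ _ (Or.inl (Or.inr rfl))
    simpa [sub_eq_zero, map_star φ] using this
  · obtain ⟨f, rfl⟩ := hof l hl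
    obtain ⟨g, rfl⟩ := hof l' hl'
    rw [hword, hword]
    exact hcomm _ _ (hφ _ (Or.inr (Or.inl ⟨f, g, rfl⟩)))
  · obtain ⟨f, rfl⟩ := hof l hl
    -- The adjoint reverses the word, so the relator used is the one with the reversed multi-index.
    obtain ⟨g, hg⟩ := hof l'.reverse (by simpa using hl')
    have h2 : (l'.reverse.map fun i => φ (star (z i))).prod = φ (zStarProd g) := by
      rw [hg, zStarProd, map_list_prod, List.map_ofFn, List.map_ofFn]
      rfl
    rw [hword, hstar, h2]
    exact hcomm _ _ (hφ _ (Or.inr (Or.inr ⟨f, g, rfl⟩)))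

/-- In an irreducible representation, the images of the coordinates form an irreducible family. -/
lemma isIrreducibleFamily_of_isIrreducibleRep {H : Type*} [NormedAddCommGroup H]
    [InnerProductSpace ℂ H] [CompleteSpace H] {π : HalfLiberatedSphere N K →⋆ₐ[ℂ] (H →L[ℂ] H)}
    (hπ : IsIrreducibleRep π) : IsIrreducibleFamily fun i => π (SphereCStar.mk _ (z i)) := by
  intro W hW hinv
  refine hπ.2 W hW fun a v hv => ?_
  have hcont : Continuous fun a => π a v :=
    ((ContinuousLinearMap.apply ℂ H v).continuous).comp
      (AddMonoidHomClass.continuous_of_bound π 1 fun a => by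
        simpa using NonUnitalStarAlgHom.norm_apply_le π a)
  -- As W is closed and a ↦ π(a) v is continuous, invariance need only be checked on polynomials.
  refine isClosed_property (SphereCStar.denseRange_mk (R := halfLiberatedRelators N K))
    (hW.preimage hcont) (fun x => ?_) a
  let S : Subalgebra ℂ (StarPoly N) :=
    { carrier := {x | ∀ v ∈ W, π (SphereCStar.mk _ x) v ∈ W}
      mul_mem' := fun {x y} hx hy v hv => by
        rw [map_mul, map_mul]
        exact hx _ (hy v hv)
      add_mem' := fun {x y} hx hy v hv => by
        rw [map_add, map_add]
        exact W.add_mem (hx v hv) (hy v hv)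
      algebraMap_mem' := fun c v hv => by
        rw [AlgHomClass.commutes, AlgHomClass.commutes, Algebra.algebraMap_eq_smul_one]
        exact W.smul_mem c hv }
  refine mem_of_z_mem S (fun i v hv => (hinv i v hv).1) (fun i v hv => ?_) x v hv
  rw [map_star, map_star]
  exact (hinv i v hv).2

theorem finrank_le_of_isIrreducibleRep (hK : 1 ≤ K) {H : Type*} [NormedAddCommGroup H]
    [InnerProductSpace ℂ H] [CompleteSpace H] {π : HalfLiberatedSphere N K →⋆ₐ[ℂ] (H →L[ℂ] H)}
    (hπ : IsIrreducibleRep π) : FiniteDimensional ℂ H ∧ Module.finrank ℂ H ≤ K := by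
  have := hπ.1
  exact (isHalfLiberated_map π).finrank_le hK (isIrreducibleFamily_of_isIrreducibleRep hπ)

end HalfLiberatedSphere

/-! ### Weighted cyclic shifts -/

namespace CyclicShift

open Matrix

variable {N K : ℕ}

lemma sum_diagonal_eq_one (a : Fin N → Fin K → ℂ) (h : ∀ k, ∑ i, a i k = 1) :
    ∑ i, diagonal (a i) = (1 : Matrix (Fin K) (Fin K) ℂ) := by
  ext k l
  rw [Matrix.sum_apply]
  by_cases hkl : k = l
  · subst hkl
    simp [h]
  · simp [hkl]

/-- A nonzero subspace invariant under a diagonal matrix with distinct entries contains a basis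
vector. -/
lemma exists_single_mem {d : Fin K → ℂ} (hd : Function.Injective d)
    {W : Submodule ℂ (EuclideanSpace ℂ (Fin K))}
    (hW : ∀ v ∈ W, toEuclideanCLM (𝕜 := ℂ) (diagonal d) v ∈ W) (hne : W ≠ ⊥) :
    ∃ k, EuclideanSpace.single k (1 : ℂ) ∈ W := by
  obtain ⟨v, hv, hv0⟩ := W.exists_mem_ne_zero_of_ne_bot hne
  obtain ⟨k, hk⟩ : ∃ k, v k ≠ 0 := by
    by_contra! h
    exact hv0 (by ext k; exact h k)
  -- Applying D - d_l for each l in s kills those coordinates and multiplies the k-th by nonzero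
  -- numbers d_k - d_l.
  have key : ∀ s : Finset (Fin K), k ∉ s → ∃ w ∈ W, w k ≠ 0 ∧ ∀ l ∈ s, w l = 0 := by
    intro s
    induction s using Finset.induction_on with
    | empty => exact fun _ => ⟨v, hv, hk, by simp⟩
    | insert l s _ ih =>
      intro hks
      obtain ⟨w, hw, hwk, hws⟩ := ih fun h => hks (Finset.mem_insert_of_mem h)
      have hval : ∀ j, (toEuclideanCLM (𝕜 := ℂ) (diagonal d) w - d l • w) j
          = (d j - d l) * w j := fun j => by
        simp [mulVec_diagonal, sub_mul]
      refine ⟨_, W.sub_mem (hW w hw) (W.smul_mem (d l) hw), ?_, fun j hj => ?_⟩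
      · rw [hval]
        refine mul_ne_zero (sub_ne_zero.2 (hd.ne ?_)) hwk
        rintro rfl
        exact hks (Finset.mem_insert_self _ _)
      · rw [hval]
        obtain rfl | hj := Finset.mem_insert.1 hj
        · rw [sub_self, zero_mul]
        · rw [hws j hj, mul_zero]
  obtain ⟨w, hw, hwk, hws⟩ := key (Finset.univ.erase k) (by simp)
  refine ⟨k, ?_⟩
  have : EuclideanSpace.single k (1 : ℂ) = (w k)⁻¹ • w := by
    ext l
    by_cases hl : l = k
    · subst hl; simp [hwk]
    · simp [hl, hws l (by simp [hl])]
  rw [this]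
  exact W.smul_mem _ hw

/-- The weights of the irreducible model. -/
noncomputable def weight (N K : ℕ) (i : Fin N) (k : Fin K) : ℂ :=
  if i.val = 0 then (√((k : ℝ) + 1)⁻¹ : ℝ)
  else if i.val = 1 then (√(1 - ((k : ℝ) + 1)⁻¹) : ℝ) else 0

lemma star_ofReal_sqrt_mul {x : ℝ} (hx : 0 ≤ x) : star ((√x : ℝ) : ℂ) * (√x : ℝ) = x := by
  rw [Complex.star_def, Complex.conj_ofReal, ← Complex.ofReal_mul, Real.mul_self_sqrt hx]

/-- The first two coordinates contribute 1/(k+1) and 1 - 1/(k+1). Having two of them leaves the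
first free to take distinct moduli; this is where N ≥ 2 enters. -/
lemma sum_star_weight_mul_weight (hN : 2 ≤ N) (k : Fin K) :
    ∑ i, star (weight N K i k) * weight N K i k = 1 := by
  obtain ⟨n, rfl⟩ := Nat.exists_eq_add_of_le' hN
  have h1 : (0 : ℝ) ≤ ((k : ℝ) + 1)⁻¹ := by positivity
  have h2 : (0 : ℝ) ≤ 1 - ((k : ℝ) + 1)⁻¹ := sub_nonneg.2 (inv_le_one_of_one_le₀ (by simp))
  rw [Fin.sum_univ_succ, Fin.sum_univ_succ, Finset.sum_eq_zero, add_zero]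
  · have e1 : weight (n + 2) K 0 k = (√((k : ℝ) + 1)⁻¹ : ℝ) := by simp [weight]
    have e2 : weight (n + 2) K (Fin.succ 0) k = (√(1 - ((k : ℝ) + 1)⁻¹) : ℝ) := by simp [weight]
    rw [e1, e2, star_ofReal_sqrt_mul h1, star_ofReal_sqrt_mul h2]
    push_cast
    ring
  · intro i _
    simp [weight]

lemma weight_zero_ne_zero (hN : 0 < N) (k : Fin K) : weight N K ⟨0, hN⟩ k ≠ 0 := by
  have : (0 : ℝ) < √((k : ℝ) + 1)⁻¹ := Real.sqrt_pos.2 (by positivity)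
  simpa only [weight, if_true, ne_eq, Complex.ofReal_eq_zero] using this.ne'

lemma injective_star_weight_mul_weight (hN : 0 < N) :
    Function.Injective fun k => star (weight N K ⟨0, hN⟩ k) * weight N K ⟨0, hN⟩ k := by
  intro k l hkl
  simp only [weight, if_true] at hkl
  rw [star_ofReal_sqrt_mul (by positivity), star_ofReal_sqrt_mul (by positivity),
    Complex.ofReal_inj, _root_.inv_inj, add_left_inj, Nat.cast_inj] at hkl
  exact Fin.ext hkl

variable [NeZero K]

/-- The matrix is supported on the `d`-th cyclic diagonal. -/
def IsBand (d : Fin K) (M : Matrix (Fin K) (Fin K) ℂ) : Prop := ∀ k l, k ≠ l + d → M k l = 0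

/-- The cyclic diagonals grade the matrices by ℤ/K. Products of K factors of equal degree d thus
have degree K d = 0, that is, they are diagonal and commute. -/
lemma IsBand.mul {d e : Fin K} {M M' : Matrix (Fin K) (Fin K) ℂ} (h : IsBand d M)
    (h' : IsBand e M') : IsBand (d + e) (M * M') := fun k l hkl => by
  rw [Matrix.mul_apply]
  refine Finset.sum_eq_zero fun m _ => ?_
  by_cases hm : m = l + e
  · rw [h k m (fun hk => hkl (by rw [hk, hm]; abel)), zero_mul]
  · rw [h' m l hm, mul_zero]

lemma IsBand.list_prod {d : Fin K} (L : List (Matrix (Fin K) (Fin K) ℂ))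
    (h : ∀ M ∈ L, IsBand d M) : IsBand (L.length • d) L.prod := by
  induction L with
  | nil =>
    intro k l hkl
    exact Matrix.one_apply_ne (by simpa using hkl)
  | cons M L ih =>
    rw [List.length_cons, succ_nsmul', List.prod_cons]
    exact (h M (by simp)).mul (ih fun M' hM' => h M' (by simp [hM']))

lemma IsBand.eq_diagonal {M : Matrix (Fin K) (Fin K) ℂ} (h : IsBand 0 M) :
    M = diagonal fun k => M k k := by
  ext k l
  by_cases hkl : k = l
  · simp [hkl]
  · rw [h k l (by simpa using hkl), diagonal_apply_ne _ hkl]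

lemma IsBand.commute {M M' : Matrix (Fin K) (Fin K) ℂ} (h : IsBand 0 M) (h' : IsBand 0 M') :
    Commute M M' := by
  rw [h.eq_diagonal, h'.eq_diagonal, Commute, SemiconjBy, diagonal_mul_diagonal,
    diagonal_mul_diagonal]
  simp only [mul_comm]

/-- Products of `K` matrices on one cyclic diagonal are diagonal. -/
lemma isBand_zero_prod_ofFn {d : Fin K} (f : Fin K → Matrix (Fin K) (Fin K) ℂ)
    (h : ∀ k, IsBand d (f k)) : IsBand 0 (List.ofFn f).prod := by
  have h1 := IsBand.list_prod (d := d) (List.ofFn f) (by simpa [List.mem_ofFn] using h)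
  have h2 : K • d = 0 := by simpa using card_nsmul_eq_zero' (x := d)
  rwa [List.length_ofFn, h2] at h1

/-- The weighted cyclic shift `eₖ ↦ aₖ eₖ₊₁`. -/
def shift (a : Fin K → ℂ) : Matrix (Fin K) (Fin K) ℂ := of fun k l => if k = l + 1 then a l else 0

lemma isBand_shift (a : Fin K → ℂ) : IsBand 1 (shift a) := fun k l hkl => by
  simp [shift, hkl]

lemma isBand_star_shift (a : Fin K → ℂ) : IsBand (-1) (star (shift a)) := fun k l hkl => by
  have : l ≠ k + 1 := fun h => hkl (by rw [h]; abel)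
  simp [shift, this, star_apply]

lemma star_shift_mul_shift (a : Fin K → ℂ) :
    star (shift a) * shift a = diagonal fun k => star (a k) * a k := by
  ext k l
  simp only [Matrix.mul_apply, star_apply, shift, of_apply, diagonal_apply]
  rw [Finset.sum_eq_single (k + 1)]
  · by_cases h : k = l <;> simp [h]
  · intro m _ hm
    simp [hm]
  · simp

lemma shift_mul_star_shift (a : Fin K → ℂ) :
    shift a * star (shift a) = diagonal fun k => a (k - 1) * star (a (k - 1)) := by
  ext k l
  simp only [Matrix.mul_apply, star_apply, shift, of_apply, diagonal_apply]
  rw [Finset.sum_eq_single (k - 1)]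
  · by_cases h : k = l <;> simp [h, eq_comm]
  · intro m _ hm
    have : k ≠ m + 1 := fun h => hm (by rw [h]; abel)
    simp [this]
  · simp

/-- Weighted shifts satisfy the half-liberated relations. -/
lemma eval_shift_eq_zero (a : Fin N → Fin K → ℂ) (ha : ∀ k, ∑ i, star (a i k) * a i k = 1)
    (r : StarPoly N) (hr : r ∈ FreeSphere.sphereRelators N ∪ halfLiberatedRelators N K) :
    StarPoly.eval (fun i => shift (a i)) r = 0 := by
  set φ := StarPoly.eval (fun i => shift (a i)) with hφ
  have hz : ∀ i, φ (StarPoly.z i) = shift (a i) := fun i => StarPoly.eval_z _ i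
  have hprod : ∀ f : Fin K → Fin N, IsBand 0 (φ (StarPoly.zProd f)) := fun f => by
    rw [StarPoly.zProd, map_list_prod, List.map_ofFn]
    exact isBand_zero_prod_ofFn (d := 1) _ fun k => by
      simpa [hz] using isBand_shift (a (f k))
  have hsprod : ∀ f : Fin K → Fin N, IsBand 0 (φ (StarPoly.zStarProd f)) := fun f => by
    rw [StarPoly.zStarProd, map_list_prod, List.map_ofFn]
    exact isBand_zero_prod_ofFn (d := -1) _ fun k => by
      simpa [map_star φ, hz] using isBand_star_shift (a (f k))
  rcases hr with (rfl | rfl) | (⟨f, g, rfl⟩ | ⟨f, g, rfl⟩)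
  · simp only [map_sub, map_sum, map_mul, map_star φ, hz, map_one, shift_mul_star_shift]
    rw [sum_diagonal_eq_one, sub_self]
    intro k
    -- The k-th entry of z_i z_i* is the squared modulus of the weight that leads into e_k, hence
    -- the shifted index.
    simpa only [mul_comm] using ha (k - 1)
  · simp only [map_sub, map_sum, map_mul, map_star φ, hz, map_one, star_shift_mul_shift]
    rw [sum_diagonal_eq_one _ ha, sub_self]
  · rw [Ring.lie_def, map_sub, map_mul, map_mul, ((hprod f).commute (hprod g)).eq, sub_self]
  · rw [Ring.lie_def, map_sub, map_mul, map_mul, ((hprod f).commute (hsprod g)).eq, sub_self]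

lemma shift_single (a : Fin K → ℂ) (k : Fin K) :
    toEuclideanCLM (𝕜 := ℂ) (shift a) (EuclideanSpace.single k 1)
      = a k • EuclideanSpace.single (k + 1) (1 : ℂ) := by
  ext l
  simp [shift, mulVec_single]

/-- A weighted shift whose weights have distinct nonzero moduli acts irreducibly. -/
lemma eq_bot_or_eq_top {a : Fin K → ℂ} (ha : ∀ k, a k ≠ 0)
    (hd : Function.Injective fun k => star (a k) * a k)
    {W : Submodule ℂ (EuclideanSpace ℂ (Fin K))}
    (h : ∀ v ∈ W, toEuclideanCLM (𝕜 := ℂ) (shift a) v ∈ W)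
    (h' : ∀ v ∈ W, toEuclideanCLM (𝕜 := ℂ) (star (shift a) * shift a) v ∈ W) :
    W = ⊥ ∨ W = ⊤ := by
  refine or_iff_not_imp_left.2 fun hne => ?_
  rw [star_shift_mul_shift] at h'
  obtain ⟨k, hk⟩ := exists_single_mem hd h' hne
  -- Since no weight vanishes, the shift carries one basis vector of W to nonzero multiples of all
  -- the others.
  have hstep : ∀ n : ℕ, EuclideanSpace.single (k + (n • 1 : Fin K)) (1 : ℂ) ∈ W := by
    intro n
    induction n with
    | zero => simpa using hk
    | succ n ih =>
      have := h _ ih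
      rw [shift_single] at this
      rw [succ_nsmul, ← add_assoc]
      exact (W.smul_mem_iff (ha _)).1 this
  have hsmul : ∀ x : Fin K, x.val • (1 : Fin K) = x := fun x => by
    open Fin.CommRing in rw [nsmul_one, Fin.cast_val_eq_self]
  have hall : ∀ l, EuclideanSpace.single l (1 : ℂ) ∈ W := fun l => by
    have := hstep (l - k).val
    rwa [hsmul, add_sub_cancel] at this
  rw [eq_top_iff, ← (EuclideanSpace.basisFun (Fin K) ℂ).toBasis.span_eq, Submodule.span_le]
  rintro _ ⟨l, rfl⟩
  simpa using hall l

end CyclicShift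

/-! ### The K-dimensional irreducible representation and non-isomorphism -/

namespace HalfLiberatedSphere

open CyclicShift

variable {N K : ℕ}

theorem exists_isIrreducibleRep (hN : 2 ≤ N) (hK : 1 ≤ K) :
    ∃ π : HalfLiberatedSphere N K →⋆ₐ[ℂ]
      (EuclideanSpace ℂ (Fin K) →L[ℂ] EuclideanSpace ℂ (Fin K)), IsIrreducibleRep π := by
  have : NeZero K := ⟨by omega⟩
  let ρ : Matrix (Fin K) (Fin K) ℂ →⋆ₐ[ℂ]
      (EuclideanSpace ℂ (Fin K) →L[ℂ] EuclideanSpace ℂ (Fin K)) :=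
    (Matrix.toEuclideanCLM (n := Fin K) (𝕜 := ℂ) : _ →⋆ₐ[ℂ] _)
  let ψ : StarPoly N →⋆ₐ[ℂ] Matrix (Fin K) (Fin K) ℂ :=
    StarPoly.eval fun i => shift (weight N K i)
  let φ := ρ.comp ψ
  have hφ : ∀ r ∈ FreeSphere.sphereRelators N ∪ halfLiberatedRelators N K, φ r = 0 := fun r hr => by
    show ρ (ψ r) = 0
    rw [eval_shift_eq_zero _ (sum_star_weight_mul_weight hN) r hr, map_zero]
  refine ⟨SphereCStar.lift φ hφ, inferInstance, fun W _ hW => ?_⟩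
  have hN0 : 0 < N := by omega
  have hz : ψ (StarPoly.z ⟨0, hN0⟩) = shift (weight N K ⟨0, hN0⟩) := StarPoly.eval_z _ _
  have hW' : ∀ x, ∀ v ∈ W, Matrix.toEuclideanCLM (𝕜 := ℂ) (ψ x) v ∈ W := fun x v hv => by
    have := hW (SphereCStar.mk _ x) v hv
    rwa [SphereCStar.lift_mk] at this
  -- The first coordinate alone already acts irreducibly, through z and z* z.
  refine eq_bot_or_eq_top (weight_zero_ne_zero hN0) (injective_star_weight_mul_weight hN0)
    (fun v hv => ?_) (fun v hv => ?_)
  · rw [← hz]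
    exact hW' _ v hv
  · rw [← hz, ← map_star, ← map_mul]
    exact hW' _ v hv

/-- Pulled back along f, an irreducible representation of dimension K' stays irreducible because f
is surjective, so the dimension bound for K applies. -/
theorem le_of_starAlgEquiv (hN : 2 ≤ N) {K' : ℕ} (hK : 1 ≤ K) (hK' : 1 ≤ K')
    (f : HalfLiberatedSphere N K ≃⋆ₐ[ℂ] HalfLiberatedSphere N K') : K' ≤ K := by
  obtain ⟨π, hπ⟩ := exists_isIrreducibleRep hN hK'
  have hirr : IsIrreducibleRep (π.comp (f : HalfLiberatedSphere N K →⋆ₐ[ℂ] _)) := by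
    refine ⟨hπ.1, fun W hW hinv => hπ.2 W hW fun a v hv => ?_⟩
    obtain ⟨b, rfl⟩ := f.surjective a
    exact hinv b v hv
  simpa using (finrank_le_of_isIrreducibleRep hK hirr).2

end HalfLiberatedSphere

theorem corollary5p5 (N : ℕ) (hN : 2 ≤ N) :
    (∀ K : ℕ, 1 ≤ K →
      (∃ π : HalfLiberatedSphere N K →⋆ₐ[ℂ]
          (EuclideanSpace ℂ (Fin K) →L[ℂ] EuclideanSpace ℂ (Fin K)), IsIrreducibleRep π) ∧
      (∀ (H : Type*) [NormedAddCommGroup H] [InnerProductSpace ℂ H] [CompleteSpace H]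
          (π : HalfLiberatedSphere N K →⋆ₐ[ℂ] (H →L[ℂ] H)), IsIrreducibleRep π →
          FiniteDimensional ℂ H ∧ Module.finrank ℂ H ≤ K)) ∧
    (∀ K K' : ℕ, 1 ≤ K → 1 ≤ K' → K ≠ K' →
      IsEmpty (HalfLiberatedSphere N K ≃⋆ₐ[ℂ] HalfLiberatedSphere N K')) := by
  refine ⟨fun K hK => ⟨HalfLiberatedSphere.exists_isIrreducibleRep hN hK, fun H _ _ _ π hπ =>
    HalfLiberatedSphere.finrank_le_of_isIrreducibleRep hK hπ⟩, fun K K' hK hK' hne => ⟨fun f => ?_⟩⟩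
  exact hne (le_antisymm (HalfLiberatedSphere.le_of_starAlgEquiv hN hK' hK f.symm)
    (HalfLiberatedSphere.le_of_starAlgEquiv hN hK hK' f))
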